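/- Let $X$ be a Hausdorff, locally compact, connected, locally connected space. Call a set $A\subseteq X$ bounded if $\overline A$ is compact. If $X$ is compact, $A$ is solid if $A$ and $X\setminus A$ are connected; if $X$ is not compact, $A$ is solid if $A$ is connected and every connected component of $X\setminus A$ is unbounded (the empty set counts as connected). Let $\mathscr K_s(X)$ be the family of compact solid sets, $\mathscr O_s^*(X)$ the family of bounded open solid sets, and $\mathscr A_s^*(X)=\mathscr K_s(X)\cup\mathscr O_s^*(X)$. A solid-set function on $X$ is a function $\lambda:\mathscr A_s^*(X)\to[0,\infty)$ such that (s1) $\sum_{i=1}^n\lambda(C_i)\le\lambda(C)$ whenever $C,C_1,\dots,C_n\in\mathscr K_s(X)$, the $C_i$ are pairwise disjoint and $\bigcup_{i=1}^n C_i\subseteq C$; (s2) $\lambda(U)=\sup\{\lambda(K):K\in\mathscr K_s(X),\ K\subseteq U\}$ for $U\in\mathscr O_s^*(X)$; (s3) $\lambda(K)=\inf\{\lambda(U):U\in\mathscr O_s^*(X),\ K\subseteq U\}$ for $K\in\mathscr K_s(X)$; (s4) $\lambda(A)=\sum_{i=1}^n\lambda(A_i)$ whenever $A,A_1,\dots,A_n\in\mathscr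 A_s^*(X)$ and $A$ is the disjoint union of $A_1,\dots,A_n$. A topological measure on $X$ is a function $\mu$, not identically $\infty$, from the family of all open and all closed subsets of $X$ to $[0,\infty]$ such that (TM1) $\mu(A\cup B)=\mu(A)+\mu(B)$ whenever $A,B$ are disjoint and each of $A$, $B$, $A\cup B$ is compact or open; (TM2) $\mu(U)=\sup\{\mu(K):K\text{ compact},\ K\subseteq U\}$ for $U$ open; (TM3) $\mu(F)=\inf\{\mu(U):U\text{ open},\ F\subseteq U\}$ for $F$ closed. Theorem. Let $\lambda$ be a solid-set function on $X$ and let $\mu$ be a topological measure on $X$ that extends $\lambda$, i.e. $\mu=\lambda$ on $\mathscr A_s^*(X)$. Then: (1) If $\lambda$ takes only the values $0$ and $1$, then $\mu$ is simple, i.e. $\mu(A)\in\{0,1\}$ for every open and every closed set $A\subseteq X$. (2) If $\sup\{\lambda(K):K\in\mathscr K_s(X)\}=M<\infty$, then $\mu$ is finite, i.e. $\mu(X)<\infty$, and $\mu(X)=M$. -/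

import Mathlib

open Set
open scoped NNReal ENNReal

section TopologicalMeasures

variable {X : Type*} [TopologicalSpace X]

/-- A set is bounded if its closure is compact. -/
def IsBoundedSet (A : Set X) : Prop := IsCompact (closure A)

/-- Solid sets. If `X` is compact, `A` is solid when `A` and its complement are connected. If `X` is
not compact, `A` is solid when `A` is connected and every connected component of its complement is
unbounded. The empty set counts as connected here. -/
def IsSolidSet (A : Set X) : Prop :=
  IsPreconnected A ∧
    (CompactSpace X → IsPreconnected Aᶜ) ∧
    (¬ CompactSpace X → ∀ x ∈ Aᶜ, ¬ IsBoundedSet (connectedComponentIn Aᶜ x))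

variable (X) in
/-- The compact solid subsets of `X`. -/
def compactSolidSets : Set (Set X) := {K | IsCompact K ∧ IsSolidSet K}

variable (X) in
/-- The bounded open solid subsets of `X`. -/
def boundedOpenSolidSets : Set (Set X) := {U | IsOpen U ∧ IsBoundedSet U ∧ IsSolidSet U}

variable (X) in
/-- The subsets of `X` that are compact solid or bounded open solid. -/
def boundedSolidSets : Set (Set X) := compactSolidSets X ∪ boundedOpenSolidSets X

/-- Solid-set functions: real nonnegative functions on the family of compact solid and bounded open
solid sets. Only the values of `l` on that family matter. -/
structure IsSolidSetFunction (l : Set X → ℝ≥0) : Prop where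
  superadditive : ∀ (n : ℕ) (C : Fin n → Set X) (D : Set X),
    (∀ i, C i ∈ compactSolidSets X) → D ∈ compactSolidSets X →
    Pairwise (fun i j => Disjoint (C i) (C j)) → (⋃ i, C i) ⊆ D →
    ∑ i, l (C i) ≤ l D
  inner_regular : ∀ U ∈ boundedOpenSolidSets X,
    IsLUB (l '' {K | K ∈ compactSolidSets X ∧ K ⊆ U}) (l U)
  outer_regular : ∀ K ∈ compactSolidSets X,
    IsGLB (l '' {U | U ∈ boundedOpenSolidSets X ∧ K ⊆ U}) (l K)
  additive : ∀ (n : ℕ) (A : Fin n → Set X) (B : Set X),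
    (∀ i, A i ∈ boundedSolidSets X) → B ∈ boundedSolidSets X →
    Pairwise (fun i j => Disjoint (A i) (A j)) → B = ⋃ i, A i →
    l B = ∑ i, l (A i)

/-- Topological measures: functions on the family of open and closed sets with values in `[0, ∞]`,
not identically `∞`. Only the values of `μ` on that family matter. -/
structure IsTopologicalMeasure (μ : Set X → ℝ≥0∞) : Prop where
  not_identically_top : ∃ A : Set X, (IsOpen A ∨ IsClosed A) ∧ μ A ≠ ∞
  additive : ∀ A B : Set X, (IsCompact A ∨ IsOpen A) → (IsCompact B ∨ IsOpen B) →
    (IsCompact (A ∪ B) ∨ IsOpen (A ∪ B)) → Disjoint A B → μ (A ∪ B) = μ A + μ B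
  inner_regular : ∀ U : Set X, IsOpen U → μ U = sSup (μ '' {K | IsCompact K ∧ K ⊆ U})
  outer_regular : ∀ F : Set X, IsClosed F → μ F = sInf (μ '' {U | IsOpen U ∧ F ⊆ U})

/-- `μ` extends `l`: they agree on the compact solid and the bounded open solid sets. -/
def ExtendsSolidSetFunction (μ : Set X → ℝ≥0∞) (l : Set X → ℝ≥0) : Prop :=
  ∀ A ∈ boundedSolidSets X, μ A = (l A : ℝ≥0∞)

/-- `μ`, as a function on the open and the closed sets, only assumes the values `0` and `1`. -/
def IsSimpleSetFunction (μ : Set X → ℝ≥0∞) : Prop :=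
  ∀ A : Set X, IsOpen A ∨ IsClosed A → μ A = 0 ∨ μ A = 1

end TopologicalMeasures

/-! A nonempty compact connected C becomes compact and solid once the bounded components of its
complement (its holes) are filled in, and each hole is itself bounded, open and solid. Additivity
gives μ(hull) = μ(C) + μ(holes). If λ is 0-1 valued and the hull has measure 1, either some hole
carries all of it and μ(C) = 0, or every hole is null, hence so is their union, and μ(C) = 1. A
compact K lies in a compact solid set, so μ(K) ≤ 1. If μ(K) < 1, then K lies in an open U with μ(U)
< 1 and is covered by finitely many disjoint compact connected subsets of U, all null. Regularity
passes the dichotomy to open and closed sets. For the total mass, compact solid sets are cofinal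
among compact sets, so inner regularity of X suffices. -/

section Topology

variable {X : Type*} [TopologicalSpace X]

/-! ### Holes and solid hulls -/

/-- The union of all connected components of `Cᶜ` that are bounded. -/
def boundedHoles (C : Set X) : Set X :=
  ⋃₀ {U | ∃ x ∈ Cᶜ, U = connectedComponentIn Cᶜ x ∧ IsBoundedSet U}

theorem IsBoundedSet.mono {A B : Set X} (hB : IsBoundedSet B) (h : A ⊆ B) : IsBoundedSet A :=
  IsCompact.of_isClosed_subset hB isClosed_closure (closure_mono h)

theorem boundedHoles_subset_compl (C : Set X) : boundedHoles C ⊆ Cᶜ := by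
  rintro y ⟨U, ⟨x, -, rfl, -⟩, hy⟩
  exact connectedComponentIn_subset _ _ hy

theorem isOpen_boundedHoles [LocallyConnectedSpace X] {C : Set X} (hC : IsClosed C) :
    IsOpen (boundedHoles C) := by
  apply isOpen_sUnion
  rintro U ⟨x, -, rfl, -⟩
  exact hC.isOpen_compl.connectedComponentIn

/-- A component whose closure missed C would be closed as well as open, hence all of X. -/
theorem closure_connectedComponentIn_compl_inter_nonempty [PreconnectedSpace X]
    [LocallyConnectedSpace X] {C : Set X} (hC : IsClosed C) (hne : C.Nonempty) {x : X}
    (hx : x ∈ Cᶜ) : (closure (connectedComponentIn Cᶜ x) ∩ C).Nonempty := by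
  by_contra h
  rw [Set.not_nonempty_iff_eq_empty, ← Set.disjoint_iff_inter_eq_empty] at h
  have hmem := mem_connectedComponentIn hx
  have hsub : closure (connectedComponentIn Cᶜ x) ⊆ connectedComponentIn Cᶜ x :=
    isPreconnected_connectedComponentIn.closure.subset_connectedComponentIn
      (subset_closure hmem) h.subset_compl_right
  have hclopen : IsClopen (connectedComponentIn Cᶜ x) :=
    ⟨closure_subset_iff_isClosed.1 hsub, hC.isOpen_compl.connectedComponentIn⟩
  obtain ⟨c, hc⟩ := hne
  have huniv := hclopen.eq_univ ⟨x, hmem⟩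
  exact connectedComponentIn_subset _ _ (huniv ▸ mem_univ c : c ∈ connectedComponentIn Cᶜ x) hc

/-- A connected closed set together with some of the components of its complement is connected. -/
theorem isPreconnected_of_union_components [PreconnectedSpace X] [LocallyConnectedSpace X]
    {C D : Set X} (hC : IsClosed C) (hne : C.Nonempty) (hconn : IsPreconnected C) (hCD : C ⊆ D)
    (hD : ∀ x ∈ D, x ∉ C → connectedComponentIn Cᶜ x ⊆ D) : IsPreconnected D := by
  obtain ⟨c, hc⟩ := hne
  apply isPreconnected_of_forall c
  intro y hy
  by_cases hyC : y ∈ C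
  · exact ⟨C, hCD, hc, hyC, hconn⟩
  obtain ⟨z, hz, hzC⟩ := closure_connectedComponentIn_compl_inter_nonempty hC ⟨c, hc⟩
    (x := y) hyC
  refine ⟨C ∪ insert z (connectedComponentIn Cᶜ y), ?_, Or.inl hc,
    Or.inr (Or.inr (mem_connectedComponentIn hyC)), ?_⟩
  · exact union_subset hCD (insert_subset (hCD hzC) (hD y hy hyC))
  · exact hconn.union z hzC (mem_insert _ _)
      (isPreconnected_connectedComponentIn.subset_closure (subset_insert _ _)
        (insert_subset hz subset_closure))

theorem bounded_component_mem_boundedOpenSolidSets [PreconnectedSpace X]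
    [LocallyConnectedSpace X] {C : Set X} (hC : IsClosed C) (hne : C.Nonempty)
    (hconn : IsPreconnected C) {x : X} (hb : IsBoundedSet (connectedComponentIn Cᶜ x)) :
    connectedComponentIn Cᶜ x ∈ boundedOpenSolidSets X := by
  have hpre : IsPreconnected (connectedComponentIn Cᶜ x)ᶜ := by
    refine isPreconnected_of_union_components hC hne hconn
      (subset_compl_comm.1 (connectedComponentIn_subset _ _)) ?_
    intro y hy _ z hz hzx
    apply hy
    rw [connectedComponentIn_eq hzx, ← connectedComponentIn_eq hz]
    exact mem_connectedComponentIn (by assumption)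
  refine ⟨hC.isOpen_compl.connectedComponentIn, hb, isPreconnected_connectedComponentIn,
    fun _ => hpre, fun hnc y hy hby => hnc ⟨?_⟩⟩
  -- The complement is its own single component; were it bounded too, X would be a union of two
  -- compact closures.
  rw [hpre.connectedComponentIn hy] at hby
  have := IsCompact.union hb hby
  rwa [← closure_union, union_compl_self, closure_univ] at this

/-- Infinitely many holes could a priori escape every compact set. But a hole leaving a relatively
compact neighbourhood W of C crosses the frontier of W, which finitely many components cover. -/
theorem isCompact_union_boundedHoles [T2Space X] [LocallyCompactSpace X] [PreconnectedSpace X]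
    [LocallyConnectedSpace X] {C : Set X} (hC : IsCompact C) (hne : C.Nonempty) :
    IsCompact (C ∪ boundedHoles C) := by
  have hclosed : IsClosed (C ∪ boundedHoles C) := by
    rw [← isOpen_compl_iff, isOpen_iff_mem_nhds]
    intro x hx
    have hxC : x ∈ Cᶜ := fun h => hx (Or.inl h)
    filter_upwards [hC.isClosed.isOpen_compl.connectedComponentIn.mem_nhds
      (mem_connectedComponentIn hxC)] with y hy
    rintro (hyC | ⟨U, ⟨z, hz, rfl, hb⟩, hyU⟩)
    · exact connectedComponentIn_subset _ _ hy hyC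
    · refine hx (Or.inr ⟨_, ⟨z, hz, rfl, hb⟩, ?_⟩)
      rw [connectedComponentIn_eq hyU, ← connectedComponentIn_eq hy]
      exact mem_connectedComponentIn hxC
  obtain ⟨W, hW, hCW, -, hWc⟩ :=
    exists_open_between_and_isCompact_closure hC isOpen_univ (subset_univ C)
  have hfront : IsCompact (frontier W) :=
    hWc.of_isClosed_subset isClosed_frontier frontier_subset_closure
  have hfC : frontier W ⊆ Cᶜ := fun y hy hyC => by
    rw [hW.frontier_eq] at hy
    exact hy.2 (hCW hyC)
  obtain ⟨t, ht, htcov⟩ := hfront.elim_nhds_subcover (fun x => connectedComponentIn Cᶜ x)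
    (fun x hx => hC.isClosed.isOpen_compl.connectedComponentIn.mem_nhds
      (mem_connectedComponentIn (hfC hx)))
  classical
  let s := t.filter fun x => IsBoundedSet (connectedComponentIn Cᶜ x)
  have hscomp : IsCompact (closure W ∪ ⋃ x ∈ s, closure (connectedComponentIn Cᶜ x)) :=
    hWc.union (s.isCompact_biUnion fun x hx => (Finset.mem_filter.1 hx).2)
  refine hscomp.of_isClosed_subset hclosed (union_subset
    (hCW.trans (subset_closure.trans subset_union_left)) ?_)
  rintro y ⟨U, ⟨x, hx, rfl, hb⟩, hy⟩
  by_cases hmeet : (connectedComponentIn Cᶜ x ∩ frontier W).Nonempty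
  · obtain ⟨z, hzx, hzW⟩ := hmeet
    obtain ⟨w, hw, hzw⟩ := mem_iUnion₂.1 (htcov hzW)
    have heq : connectedComponentIn Cᶜ w = connectedComponentIn Cᶜ x := by
      rw [connectedComponentIn_eq hzx, connectedComponentIn_eq hzw]
    exact Or.inr (mem_iUnion₂.2 ⟨w, Finset.mem_filter.2 ⟨hw, heq ▸ hb⟩,
      subset_closure (heq ▸ hy)⟩)
  · left
    obtain ⟨z, hz, hzC⟩ := closure_connectedComponentIn_compl_inter_nonempty hC.isClosed hne hx
    obtain ⟨v, hvW, hvx⟩ := mem_closure_iff.1 hz W hW (hCW hzC)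
    by_contra hyW
    refine hmeet ?_
    -- The hole accumulates at C, so it meets W; missing the frontier, it would be split by W and
    -- the exterior of W.
    have h1 := isPreconnected_connectedComponentIn (F := Cᶜ) (x := x) W (closure W)ᶜ hW
      isClosed_closure.isOpen_compl
    by_contra hno
    obtain ⟨u, -, huW, huc⟩ := h1 (fun u hu => by
      by_cases huW : u ∈ W
      · exact Or.inl huW
      · refine Or.inr fun huc => hno ⟨u, hu, ?_⟩
        rw [hW.frontier_eq]
        exact ⟨huc, huW⟩) ⟨v, hvx, hvW⟩ ⟨y, hy, hyW⟩
    exact huc (subset_closure huW)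

theorem union_boundedHoles_mem_compactSolidSets [T2Space X] [LocallyCompactSpace X]
    [PreconnectedSpace X] [LocallyConnectedSpace X] {C : Set X} (hC : IsCompact C)
    (hne : C.Nonempty) (hconn : IsPreconnected C) :
    C ∪ boundedHoles C ∈ compactSolidSets X := by
  refine ⟨isCompact_union_boundedHoles hC hne, ?_, ?_, ?_⟩
  · refine isPreconnected_of_union_components hC.isClosed hne hconn subset_union_left ?_
    rintro x (hx | ⟨U, ⟨z, hz, rfl, hb⟩, hxz⟩) hxC
    · exact absurd hx hxC
    · rw [← connectedComponentIn_eq hxz]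
      exact fun y hy => Or.inr ⟨_, ⟨z, hz, rfl, hb⟩, hy⟩
  · intro _
    have : (C ∪ boundedHoles C)ᶜ = ∅ := by
      rw [compl_empty_iff, eq_univ_iff_forall]
      intro x
      by_cases hx : x ∈ C
      · exact Or.inl hx
      · exact Or.inr ⟨_, ⟨x, hx, rfl, isClosed_closure.isCompact⟩, mem_connectedComponentIn hx⟩
    rw [this]
    exact isPreconnected_empty
  · intro _ x hx hb
    have hxC : x ∈ Cᶜ := fun h => hx (Or.inl h)
    have hbx : ¬ IsBoundedSet (connectedComponentIn Cᶜ x) := fun h =>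
      hx (Or.inr ⟨_, ⟨x, hxC, rfl, h⟩, mem_connectedComponentIn hxC⟩)
    -- Unbounded components of the complement of C avoid the holes, so they survive in the
    -- complement of the hull.
    refine hbx (hb.mono ?_)
    refine isPreconnected_connectedComponentIn.subset_connectedComponentIn
      (mem_connectedComponentIn hxC) ?_
    rintro y hy (hyC | ⟨U, ⟨z, hz, rfl, hbz⟩, hyz⟩)
    · exact connectedComponentIn_subset _ _ hy hyC
    · exact hbx (by rwa [connectedComponentIn_eq hy, ← connectedComponentIn_eq hyz])

/-! ### Compact connected sets around and between given sets -/

theorem exists_mem_nhds_isCompact_isPreconnected_subset [T2Space X] [LocallyCompactSpace X]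
    [LocallyConnectedSpace X] {U : Set X} (hU : IsOpen U) {x : X} (hx : x ∈ U) :
    ∃ V ∈ nhds x, IsCompact V ∧ IsPreconnected V ∧ V ⊆ U := by
  obtain ⟨K, hK, hKU, hKc⟩ := local_compact_nhds (hU.mem_nhds hx)
  have hxi : x ∈ interior K := mem_interior_iff_mem_nhds.2 hK
  have hcl : closure (connectedComponentIn (interior K) x) ⊆ K :=
    closure_minimal ((connectedComponentIn_subset _ _).trans interior_subset) hKc.isClosed
  exact ⟨closure (connectedComponentIn (interior K) x),
    Filter.mem_of_superset (isOpen_interior.connectedComponentIn.mem_nhds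
      (mem_connectedComponentIn hxi)) subset_closure,
    hKc.of_isClosed_subset isClosed_closure hcl,
    isPreconnected_connectedComponentIn.closure, hcl.trans hKU⟩

/-- Gluing compact connected neighbourhoods makes the set of points reachable from x clopen. -/
theorem exists_isCompact_isPreconnected_mem_mem [T2Space X] [LocallyCompactSpace X]
    [PreconnectedSpace X] [LocallyConnectedSpace X] (x y : X) :
    ∃ D, IsCompact D ∧ IsPreconnected D ∧ x ∈ D ∧ y ∈ D := by
  let S : Set X := {y | ∃ D, IsCompact D ∧ IsPreconnected D ∧ x ∈ D ∧ y ∈ D}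
  have key : ∀ z, ∃ V ∈ nhds z, (V ∩ S).Nonempty → V ⊆ S := fun z => by
    obtain ⟨V, hV, hVc, hVp, -⟩ :=
      exists_mem_nhds_isCompact_isPreconnected_subset isOpen_univ (mem_univ z)
    refine ⟨V, hV, ?_⟩
    rintro ⟨w, hwV, D, hDc, hDp, hxD, hwD⟩ v hv
    exact ⟨D ∪ V, hDc.union hVc, hDp.union w hwD hwV hVp, Or.inl hxD, Or.inr hv⟩
  have hclopen : IsClopen S := by
    constructor
    · rw [← isOpen_compl_iff, isOpen_iff_mem_nhds]
      intro z hz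
      obtain ⟨V, hV, hVS⟩ := key z
      filter_upwards [hV] with v hv hvS
      exact hz (hVS ⟨v, hv, hvS⟩ (mem_of_mem_nhds hV))
    · rw [isOpen_iff_mem_nhds]
      intro z hz
      obtain ⟨V, hV, hVS⟩ := key z
      exact Filter.mem_of_superset hV (hVS ⟨z, mem_of_mem_nhds hV, hz⟩)
  have hxS : x ∈ S :=
    ⟨{x}, isCompact_singleton, isPreconnected_singleton, mem_singleton x, mem_singleton x⟩
  have huniv := hclopen.eq_univ ⟨x, hxS⟩
  exact (huniv ▸ mem_univ y : y ∈ S)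

/-- Routing every piece of a finite cover through one base point gives a compact connected superset,
whose holes are then filled. -/
theorem exists_compactSolidSet_superset [T2Space X] [LocallyCompactSpace X]
    [PreconnectedSpace X] [LocallyConnectedSpace X] {K : Set X} (hK : IsCompact K) :
    ∃ D ∈ compactSolidSets X, K ⊆ D := by
  rcases isEmpty_or_nonempty X with hX | ⟨⟨x⟩⟩
  · exact ⟨K, ⟨hK, Set.subsingleton_of_subsingleton.isPreconnected,
      fun _ => Set.subsingleton_of_subsingleton.isPreconnected, fun _ x => isEmptyElim x⟩,
      subset_rfl⟩
  have h : ∃ D, IsCompact D ∧ IsPreconnected D ∧ x ∈ D ∧ K ⊆ D := by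
    refine hK.induction_on (p := fun K => ∃ D, IsCompact D ∧ IsPreconnected D ∧ x ∈ D ∧ K ⊆ D)
      ?_ ?_ ?_ ?_
    · exact ⟨{x}, isCompact_singleton, isPreconnected_singleton, mem_singleton x, empty_subset _⟩
    · rintro s t hst ⟨D, h1, h2, h3, h4⟩
      exact ⟨D, h1, h2, h3, hst.trans h4⟩
    · rintro s t ⟨D, h1, h2, h3, h4⟩ ⟨E, h5, h6, h7, h8⟩
      exact ⟨D ∪ E, h1.union h5, h2.union x h3 h7 h6, Or.inl h3, union_subset_union h4 h8⟩
    · intro z _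
      obtain ⟨V, hV, hVc, hVp, -⟩ :=
        exists_mem_nhds_isCompact_isPreconnected_subset isOpen_univ (mem_univ z)
      obtain ⟨D, hDc, hDp, hxD, hzD⟩ := exists_isCompact_isPreconnected_mem_mem x z
      exact ⟨V, mem_nhdsWithin_of_mem_nhds hV, D ∪ V, hDc.union hVc,
        hDp.union z hzD (mem_of_mem_nhds hV) hVp, Or.inl hxD, subset_union_right⟩
  obtain ⟨D, hDc, hDp, hxD, hKD⟩ := h
  exact ⟨_, union_boundedHoles_mem_compactSolidSets hDc ⟨x, hxD⟩ hDp,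
    hKD.trans subset_union_left⟩

/-- Finitely many compact connected sets can be merged into disjoint ones. -/
theorem exists_pairwiseDisjoint_sUnion_eq {T : Set (Set X)} (hT : T.Finite)
    (h : ∀ A ∈ T, IsCompact A ∧ IsPreconnected A) :
    ∃ S : Set (Set X), S.Finite ∧ (∀ A ∈ S, IsCompact A ∧ IsPreconnected A) ∧
      S.PairwiseDisjoint id ∧ ⋃₀ S = ⋃₀ T := by
  induction T, hT using Set.Finite.induction_on with
  | empty => exact ⟨∅, finite_empty, by simp, by simp, rfl⟩
  | @insert D T _ _ ih =>
    obtain ⟨S, hSf, hS, hSd, hSU⟩ := ih fun A hA => h A (mem_insert_of_mem _ hA)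
    obtain ⟨hDc, hDp⟩ := h D (mem_insert _ _)
    rcases D.eq_empty_or_nonempty with rfl | ⟨d, hd⟩
    · exact ⟨S, hSf, hS, hSd, by simp [hSU]⟩
    -- The members of `S` that meet `D` are merged with it into one connected set.
    set M : Set (Set X) := {A ∈ S | (A ∩ D).Nonempty} with hM
    refine ⟨insert (D ∪ ⋃₀ M) {A ∈ S | ¬ (A ∩ D).Nonempty},
      (hSf.subset (sep_subset _ _)).insert _, ?_, ?_, ?_⟩
    · rintro A (rfl | hA)
      · refine ⟨hDc.union ((hSf.subset (sep_subset _ _)).isCompact_sUnion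
          fun A hA => (hS A hA.1).1), isPreconnected_of_forall d ?_⟩
        rintro y (hy | ⟨A, hA, hy⟩)
        · exact ⟨D, subset_union_left, hd, hy, hDp⟩
        · obtain ⟨z, hzA, hzD⟩ := hA.2
          exact ⟨D ∪ A, union_subset_union_right _ (subset_sUnion_of_mem hA), Or.inl hd,
            Or.inr hy, hDp.union z hzD hzA (hS A hA.1).2⟩
      · exact hS A hA.1
    · refine (hSd.subset (sep_subset _ _)).insert ?_
      rintro A ⟨hA, hAD⟩ _
      refine disjoint_union_left.2 ⟨?_, ?_⟩
      · rw [id, disjoint_comm, disjoint_iff_inter_eq_empty]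
        exact not_nonempty_iff_eq_empty.1 hAD
      · rw [disjoint_sUnion_left]
        rintro B ⟨hB, hBD⟩
        exact hSd hB hA fun h => hAD (h ▸ hBD)
    · rw [sUnion_insert, sUnion_insert, ← hSU, union_assoc, ← sUnion_union]
      congr 2
      ext A
      simp only [hM, mem_union, mem_sep_iff]
      tauto

theorem exists_sUnion_isPreconnected_between [T2Space X] [LocallyCompactSpace X]
    [LocallyConnectedSpace X] {K U : Set X} (hK : IsCompact K) (hU : IsOpen U) (hKU : K ⊆ U) :
    ∃ T : Set (Set X), T.Finite ∧ (∀ A ∈ T, IsCompact A ∧ IsPreconnected A) ∧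
      K ⊆ ⋃₀ T ∧ ⋃₀ T ⊆ U := by
  choose! V hV hVc hVp hVU using fun x (hx : x ∈ U) =>
    exists_mem_nhds_isCompact_isPreconnected_subset hU hx
  obtain ⟨t, ht, hcov⟩ := hK.elim_nhds_subcover V fun x hx => hV x (hKU hx)
  refine ⟨V '' t, t.finite_toSet.image V, ?_, by simpa using hcov, ?_⟩
  · rintro _ ⟨x, hx, rfl⟩
    exact ⟨hVc x (hKU (ht x hx)), hVp x (hKU (ht x hx))⟩
  · refine sUnion_subset ?_
    rintro _ ⟨x, hx, rfl⟩
    exact hVU x (hKU (ht x hx))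

end Topology

/-! ### Measures of null unions, compact sets and the whole space -/

namespace IsTopologicalMeasure

variable {X : Type*} [TopologicalSpace X] {μ : Set X → ℝ≥0∞}

theorem mono_of_isOpen_right (hμ : IsTopologicalMeasure μ) {A U : Set X}
    (hA : IsOpen A ∨ IsClosed A) (hU : IsOpen U) (h : A ⊆ U) : μ A ≤ μ U := by
  rcases hA with hA | hA
  · rw [hμ.inner_regular A hA, hμ.inner_regular U hU]
    exact sSup_le_sSup (image_mono fun K hK => ⟨hK.1, hK.2.trans h⟩)
  · rw [hμ.outer_regular A hA]
    exact sInf_le ⟨U, ⟨hU, h⟩, rfl⟩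

theorem mono (hμ : IsTopologicalMeasure μ) {A B : Set X} (hA : IsOpen A ∨ IsClosed A)
    (hB : IsOpen B ∨ IsClosed B) (h : A ⊆ B) : μ A ≤ μ B := by
  rcases hB with hB | hB
  · exact hμ.mono_of_isOpen_right hA hB h
  · rw [hμ.outer_regular B hB]
    refine le_sInf ?_
    rintro _ ⟨U, ⟨hU, hBU⟩, rfl⟩
    exact hμ.mono_of_isOpen_right hA hU (h.trans hBU)

theorem empty (hμ : IsTopologicalMeasure μ) : μ ∅ = 0 := by
  obtain ⟨A, hA, hfin⟩ := hμ.not_identically_top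
  have hne : μ ∅ ≠ ∞ :=
    ne_top_of_le_ne_top hfin (hμ.mono (Or.inl isOpen_empty) hA (empty_subset A))
  have h := hμ.additive ∅ ∅ (Or.inr isOpen_empty) (Or.inr isOpen_empty)
    (by simp) (disjoint_empty ∅)
  rw [union_empty] at h
  exact ((ENNReal.add_right_inj hne).1 ((add_zero _).trans h)).symm

theorem sUnion_eq_zero (hμ : IsTopologicalMeasure μ) {S : Set (Set X)} (hS : S.Finite)
    (hd : S.PairwiseDisjoint id) (h0 : ∀ A ∈ S, μ A = 0)
    (h : (∀ A ∈ S, IsCompact A) ∨ ∀ A ∈ S, IsOpen A) : μ (⋃₀ S) = 0 := by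
  induction S, hS using Set.Finite.induction_on with
  | empty => simpa using hμ.empty
  | @insert D S hDS hSf ih =>
    have ih' := ih (hd.subset (subset_insert _ _)) (fun A hA => h0 A (mem_insert_of_mem _ hA))
      (h.imp (fun h A hA => h A (mem_insert_of_mem _ hA))
        fun h A hA => h A (mem_insert_of_mem _ hA))
    have hdisj : Disjoint D (⋃₀ S) := by
      rw [disjoint_sUnion_right]
      exact fun A hA => hd (mem_insert _ _) (mem_insert_of_mem _ hA) fun e => hDS (e ▸ hA)
    rw [sUnion_insert]
    rcases h with h | h
    · have h1 := h D (mem_insert _ _)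
      have h2 := hSf.isCompact_sUnion fun A hA => h A (mem_insert_of_mem _ hA)
      rw [hμ.additive _ _ (Or.inl h1) (Or.inl h2) (Or.inl (h1.union h2)) hdisj,
        h0 D (mem_insert _ _), ih', add_zero]
    · have h1 := h D (mem_insert _ _)
      have h2 := isOpen_sUnion fun A hA => h A (mem_insert_of_mem D hA)
      rw [hμ.additive _ _ (Or.inr h1) (Or.inr h2) (Or.inr (h1.union h2)) hdisj,
        h0 D (mem_insert _ _), ih', add_zero]

/-- Any compact subset of the union is covered by finitely many members, so finite additivity and
inner regularity suffice. -/
theorem sUnion_open_eq_zero [T2Space X] (hμ : IsTopologicalMeasure μ) {S : Set (Set X)}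
    (hd : S.PairwiseDisjoint id) (h0 : ∀ A ∈ S, μ A = 0) (ho : ∀ A ∈ S, IsOpen A) :
    μ (⋃₀ S) = 0 := by
  rw [hμ.inner_regular _ (isOpen_sUnion ho)]
  refine sSup_eq_bot.2 ?_
  rintro _ ⟨K, ⟨hK, hKS⟩, rfl⟩
  obtain ⟨T, hTS, hTf, hKT⟩ := hK.elim_finite_subcover_image (c := id) ho
    (by rwa [sUnion_eq_biUnion] at hKS)
  have hT0 := hμ.sUnion_eq_zero hTf (hd.subset hTS) (fun A hA => h0 A (hTS hA))
    (Or.inr fun A hA => ho A (hTS hA))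
  have hK' : K ⊆ ⋃₀ T := by rwa [sUnion_eq_biUnion]
  exact le_bot_iff.1 <| (hμ.mono (Or.inr hK.isClosed)
    (Or.inl (isOpen_sUnion fun A hA => ho A (hTS hA))) hK').trans hT0.le

variable [T2Space X] [LocallyCompactSpace X] [PreconnectedSpace X] [LocallyConnectedSpace X]

theorem eq_zero_or_one_of_isPreconnected (hμ : IsTopologicalMeasure μ)
    (h01 : ∀ A ∈ boundedSolidSets X, μ A = 0 ∨ μ A = 1) {C : Set X} (hC : IsCompact C)
    (hconn : IsPreconnected C) : μ C = 0 ∨ μ C = 1 := by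
  rcases C.eq_empty_or_nonempty with rfl | hne
  · exact Or.inl hμ.empty
  have hopen := isOpen_boundedHoles hC.isClosed
  have hhull := union_boundedHoles_mem_compactSolidSets hC hne hconn
  have hadd := hμ.additive C (boundedHoles C) (Or.inl hC) (Or.inr hopen) (Or.inl hhull.1)
    (disjoint_compl_right.mono_right (boundedHoles_subset_compl C))
  rcases h01 _ (Or.inl hhull) with h | h
  · rw [h] at hadd
    exact Or.inl (add_eq_zero.1 hadd.symm).1
  rw [h] at hadd
  by_cases hex : ∃ x ∈ Cᶜ, IsBoundedSet (connectedComponentIn Cᶜ x) ∧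
      μ (connectedComponentIn Cᶜ x) = 1
  · obtain ⟨x, hx, hb, h1⟩ := hex
    have hle : 1 ≤ μ (boundedHoles C) := by
      rw [← h1]
      exact hμ.mono (Or.inl hC.isClosed.isOpen_compl.connectedComponentIn) (Or.inl hopen)
        (subset_sUnion_of_mem ⟨x, hx, rfl, hb⟩)
    have heq : μ (boundedHoles C) = 1 := le_antisymm (hadd ▸ le_add_self) hle
    rw [heq] at hadd
    exact Or.inl ((ENNReal.add_left_inj ENNReal.one_ne_top).1 ((zero_add _).trans hadd)).symm
  · have h0 : μ (boundedHoles C) = 0 := by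
      refine hμ.sUnion_open_eq_zero ?_ ?_ ?_
      · rintro _ ⟨x, hx, rfl, -⟩ _ ⟨y, hy, rfl, -⟩ hxy
        refine disjoint_left.2 fun z hzx hzy => hxy ?_
        rw [connectedComponentIn_eq hzx, connectedComponentIn_eq hzy]
      · rintro _ ⟨x, hx, rfl, hb⟩
        exact (h01 _ (Or.inr (bounded_component_mem_boundedOpenSolidSets hC.isClosed hne hconn
          hb))).resolve_right fun h1 => hex ⟨x, hx, hb, h1⟩
      · rintro _ ⟨x, hx, rfl, hb⟩
        exact hC.isClosed.isOpen_compl.connectedComponentIn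
    rw [h0, add_zero] at hadd
    exact Or.inr hadd.symm

theorem eq_zero_or_one_of_isCompact (hμ : IsTopologicalMeasure μ)
    (h01 : ∀ A ∈ boundedSolidSets X, μ A = 0 ∨ μ A = 1) {K : Set X} (hK : IsCompact K) :
    μ K = 0 ∨ μ K = 1 := by
  have hle : μ K ≤ 1 := by
    obtain ⟨D, hD, hKD⟩ := exists_compactSolidSet_superset hK
    refine (hμ.mono (Or.inr hK.isClosed) (Or.inr hD.1.isClosed) hKD).trans ?_
    rcases h01 D (Or.inl hD) with h | h <;> simp [h]
  by_cases hge : 1 ≤ μ K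
  · exact Or.inr (le_antisymm hle hge)
  left
  rw [not_le, hμ.outer_regular K hK.isClosed, sInf_lt_iff] at hge
  obtain ⟨_, ⟨U, ⟨hU, hKU⟩, rfl⟩, hU1⟩ := hge
  obtain ⟨T, hTf, hT, hKT, hTU⟩ := exists_sUnion_isPreconnected_between hK hU hKU
  obtain ⟨S, hSf, hS, hSd, hST⟩ := exists_pairwiseDisjoint_sUnion_eq hTf hT
  have h0 : μ (⋃₀ S) = 0 := by
    refine hμ.sUnion_eq_zero hSf hSd (fun A hA => ?_) (Or.inl fun A hA => (hS A hA).1)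
    -- Each piece lies in `U`, whose measure is below 1, which leaves only the value 0.
    refine (hμ.eq_zero_or_one_of_isPreconnected h01 (hS A hA).1 (hS A hA).2).resolve_right
      fun h => ?_
    have := hμ.mono (Or.inr (hS A hA).1.isClosed) (Or.inl hU)
      ((subset_sUnion_of_mem hA).trans (hST.trans_subset hTU))
    exact absurd (h ▸ this) (not_le.2 hU1)
  have hc := hSf.isCompact_sUnion fun A hA => (hS A hA).1
  exact le_antisymm
    (h0 ▸ hμ.mono (Or.inr hK.isClosed) (Or.inr hc.isClosed) (hKT.trans hST.symm.subset)) zero_le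

theorem isSimpleSetFunction (hμ : IsTopologicalMeasure μ)
    (h01 : ∀ A ∈ boundedSolidSets X, μ A = 0 ∨ μ A = 1) : IsSimpleSetFunction μ := by
  have hopen : ∀ U : Set X, IsOpen U → μ U = 0 ∨ μ U = 1 := fun U hU => by
    rw [hμ.inner_regular U hU]
    by_cases h : ∃ K, (IsCompact K ∧ K ⊆ U) ∧ μ K = 1
    · obtain ⟨K, hK, hK1⟩ := h
      refine Or.inr (le_antisymm (sSup_le ?_) (le_sSup ⟨K, hK, hK1⟩))
      rintro _ ⟨L, hL, rfl⟩
      rcases hμ.eq_zero_or_one_of_isCompact h01 hL.1 with h | h <;> simp [h]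
    · refine Or.inl (sSup_eq_bot.2 ?_)
      rintro _ ⟨L, hL, rfl⟩
      exact (hμ.eq_zero_or_one_of_isCompact h01 hL.1).resolve_right fun h1 => h ⟨L, hL, h1⟩
  rintro A (hA | hA)
  · exact hopen A hA
  · rw [hμ.outer_regular A hA]
    by_cases h : ∃ U, (IsOpen U ∧ A ⊆ U) ∧ μ U = 0
    · obtain ⟨U, hU, hU0⟩ := h
      exact Or.inl (le_antisymm (sInf_le ⟨U, hU, hU0⟩) zero_le)
    · have h1 : ∀ U, IsOpen U ∧ A ⊆ U → μ U = 1 := fun U hU =>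
        (hopen U hU.1).resolve_left fun h0 => h ⟨U, hU, h0⟩
      -- With no null open superset, all have measure 1; `univ` shows that there is at least one.
      refine Or.inr (le_antisymm
        (sInf_le ⟨univ, ⟨isOpen_univ, subset_univ A⟩, h1 univ ⟨isOpen_univ, subset_univ A⟩⟩)
        (le_sInf ?_))
      rintro _ ⟨U, hU, rfl⟩
      exact (h1 U hU).ge

theorem univ_eq_sSup_compactSolidSets (hμ : IsTopologicalMeasure μ) :
    μ univ = sSup (μ '' compactSolidSets X) := by
  refine le_antisymm ?_ (sSup_le ?_)
  · rw [hμ.inner_regular univ isOpen_univ]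
    refine sSup_le ?_
    rintro _ ⟨K, ⟨hK, -⟩, rfl⟩
    obtain ⟨D, hD, hKD⟩ := exists_compactSolidSet_superset hK
    exact (hμ.mono (Or.inr hK.isClosed) (Or.inr hD.1.isClosed) hKD).trans (le_sSup ⟨D, hD, rfl⟩)
  · rintro _ ⟨K, hK, rfl⟩
    exact hμ.mono (Or.inr hK.1.isClosed) (Or.inl isOpen_univ) (subset_univ K)

end IsTopologicalMeasure

theorem mainTheorem6 {X : Type*} [TopologicalSpace X] [T2Space X] [LocallyCompactSpace X]
    [PreconnectedSpace X] [LocallyConnectedSpace X]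
    (l : Set X → ℝ≥0) (hl : IsSolidSetFunction l)
    (μ : Set X → ℝ≥0∞) (hμ : IsTopologicalMeasure μ) (hext : ExtendsSolidSetFunction μ l) :
    ((∀ A ∈ boundedSolidSets X, l A = 0 ∨ l A = 1) → IsSimpleSetFunction μ) ∧
    (∀ M : ℝ≥0, IsLUB (l '' compactSolidSets X) M → μ univ < ∞ ∧ μ univ = (M : ℝ≥0∞)) := by
  refine ⟨fun h => hμ.isSimpleSetFunction fun A hA => ?_, fun M hM => ?_⟩
  · rw [hext A hA]
    exact_mod_cast h A hA
  · have heq : μ univ = (M : ℝ≥0∞) := by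
      rw [hμ.univ_eq_sSup_compactSolidSets]
      refine le_antisymm (sSup_le ?_) ?_
      · rintro _ ⟨K, hK, rfl⟩
        rw [hext K (Or.inl hK)]
        exact_mod_cast hM.1 ⟨K, hK, rfl⟩
      · refine le_of_forall_lt fun c hc => ?_
        lift c to ℝ≥0 using hc.ne_top
        obtain ⟨_, ⟨K, hK, rfl⟩, hcK, -⟩ := hM.exists_between (ENNReal.coe_lt_coe.1 hc)
        refine lt_of_lt_of_le (ENNReal.coe_lt_coe.2 hcK) ?_
        rw [← hext K (Or.inl hK)]
        exact le_sSup ⟨K, hK, rfl⟩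
    exact ⟨heq ▸ ENNReal.coe_lt_top, heq⟩
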